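/- Let $X$ be a complex Banach space and let $T$ be a bounded linear operator on $X$ that is weakly almost periodic, i.e. for every $x\in X$ the orbit $\{T^n x\}_{n\ge 0}$ has compact closure in the weak topology of $X$. Let $\mathbb T=\{\lambda\in\mathbb C:|\lambda|=1\}$ and suppose that $\sigma(T)\cap\mathbb T$ is (finite, possibly empty, or infinite) countable. Then $T$ is almost periodic, i.e. for every $x\in X$ the orbit $\{T^n x\}_{n\ge 0}$ has compact closure in the norm topology. Moreover, the subspace $\{z\in X:\|T^n z\|\to 0\}$ is closed, and $X$ is the (topological) direct sum of closed subspaces $$X=\overline{\operatorname{span}}\{y\in X: Ty=\lambda y\ \text{for some}\ \lambda\in\mathbb T\}\ \oplus\ \{z\in X:\ \|T^n z\|\to 0\}.$$ -/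

import Mathlib

open Filter Topology

section PowerOrbits

variable {𝕜 : Type*} [RCLike 𝕜] {X : Type*} [NormedAddCommGroup X] [NormedSpace 𝕜 X]

/-- `T` is almost periodic: every orbit `{Tⁿ x : n ≥ 0}` is conditionally compact, that is, its
norm closure is compact. -/
def IsAlmostPeriodicOp (T : X →L[𝕜] X) : Prop :=
  ∀ x : X, IsCompact (closure (Set.range fun n : ℕ => (T ^ n) x))

/-- `T` is weakly almost periodic: every orbit `{Tⁿ x : n ≥ 0}` is conditionally weakly compact,
that is, its closure in the weak topology is weakly compact. -/
def IsWeaklyAlmostPeriodicOp (T : X →L[𝕜] X) : Prop :=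
  ∀ x : X, IsCompact (closure (Set.range fun n : ℕ => toWeakSpace 𝕜 X ((T ^ n) x)))

/-- The closed linear manifold generated by the eigenvectors of `T` whose eigenvalue has
modulus one. -/
def unimodularEigenspan (T : X →L[𝕜] X) : Submodule 𝕜 X :=
  (Submodule.span 𝕜 {y : X | ∃ c : 𝕜, ‖c‖ = 1 ∧ T y = c • y}).topologicalClosure

/-- The subspace of all `z` with `‖Tⁿ z‖ → 0`. -/
def stableSubspace (T : X →L[𝕜] X) : Submodule 𝕜 X where
  carrier := {z : X | Tendsto (fun n : ℕ => ‖(T ^ n) z‖) atTop (𝓝 0)}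
  zero_mem' := by simp
  add_mem' := by
    intro a b ha hb
    simp only [Set.mem_ofPred_eq, ← tendsto_zero_iff_norm_tendsto_zero] at ha hb ⊢
    simpa using ha.add hb
  smul_mem' := by
    intro c a ha
    simp only [Set.mem_ofPred_eq, ← tendsto_zero_iff_norm_tendsto_zero] at ha ⊢
    simpa using ha.const_smul c

end PowerOrbits

/-! Let `E` be the closed span of the unimodular eigenvectors. The heart is that every orbit tends
to `E`. Send `x` to the class `J x` of the sequence `Tⁿ x mod E` in bounded sequences modulo null
sequences; `J` intertwines `T` with the shift `S`, an invertible isometry. The resolvent of `S` at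
`z` is bounded by `1 / |1 - ‖z‖|`, and `z ↦ R(z, S) J x` continues across the circle as `J R(z, T)
x` off the countable peripheral spectrum. Such a function has at most a simple pole at each isolated
singularity. The residue at `c` is a limit of `J` on Abel means of `c⁻ⁿ Tⁿ x`; weak compactness
makes these means cluster weakly at a solution of `T y = c y`, which `J` kills. So isolated
singularities are removable, a countable closed set of singularities always has an isolated point,
and Liouville gives `J x = 0` (`eq_zero_of_countable_singularities`, `residue_eq_zero`,
`tendsto_mkQ_orbit`). Orbits in `E` are totally bounded, hence so are all orbits. Along an
ultrafilter with `cⁿ → 1` for every unimodular `c`, the limit of `Tⁿ x` is the component of `x` in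
`E`. -/

/-! ### Removable singularities on the unit circle -/

/-- A function of growth `C / |1 - ‖z‖|` which is holomorphic on a disc of radius `t` about `c` is
bounded at `c` by a multiple of `1 / t`, even if the disc meets the unit circle. -/
theorem Complex.norm_mul_le_of_sphere_bound {E : Type*} [NormedAddCommGroup E] [NormedSpace ℂ E]
    {g : ℂ → E} {c : ℂ} {t C : ℝ} (ht : 0 < t) (hC0 : 0 ≤ C)
    (hg : DifferentiableOn ℂ g (Metric.closedBall c t))
    (hC : ∀ z : ℂ, ‖z‖ ≠ 1 → z ∈ Metric.sphere c t → ‖g z‖ ≤ C / |1 - ‖z‖|) :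
    ‖c‖ * t * ‖g c‖ ≤ C * (‖c‖ + t + 1) := by
  -- On the sphere the conjugate of `z - c` is `t² / (z - c)`, so there `(z - c)(‖z‖² - 1)` equals
  -- this polynomial. It cancels the blow-up at the unit circle, and `p c = c t²`.
  let p : ℂ → ℂ := fun z => (starRingEnd ℂ) c * (z - c) ^ 2
    + ((‖c‖ ^ 2 + t ^ 2 - 1 : ℝ) : ℂ) * (z - c) + c * (t : ℂ) ^ 2
  have hp : Differentiable ℂ p := by fun_prop
  have hpn : ∀ z ∈ Metric.sphere c t, ‖p z‖ = t * |‖z‖ ^ 2 - 1| := by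
    intro z hz
    obtain ⟨w, rfl⟩ : ∃ w, z = c + w := ⟨z - c, by ring⟩
    have hw : ‖w‖ = t := by simpa [dist_eq_norm] using hz
    have hw2 : (t : ℂ) ^ 2 = w * (starRingEnd ℂ) w := by
      rw [Complex.mul_conj, Complex.normSq_eq_norm_sq, hw]; push_cast; rfl
    have hc2 : (‖c‖ : ℂ) ^ 2 = c * (starRingEnd ℂ) c := by
      rw [Complex.mul_conj, Complex.normSq_eq_norm_sq]; push_cast; rfl
    have hz2 : (‖c + w‖ : ℂ) ^ 2 = (c + w) * (starRingEnd ℂ) (c + w) := by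
      rw [Complex.mul_conj, Complex.normSq_eq_norm_sq]; push_cast; rfl
    have : p (c + w) = w * ((‖c + w‖ ^ 2 - 1 : ℝ) : ℂ) := by
      simp only [p]
      push_cast
      rw [hz2, hc2, hw2, map_add]
      ring
    rw [this, norm_mul, hw, Complex.norm_real, Real.norm_eq_abs]
  have hle : ∀ z ∈ Metric.sphere c t, ‖z‖ ≤ ‖c‖ + t := by
    intro z hz
    have : ‖z - c‖ = t := by simpa [dist_eq_norm] using hz
    calc ‖z‖ = ‖c + (z - c)‖ := by congr 1; ring
      _ ≤ ‖c‖ + ‖z - c‖ := norm_add_le _ _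
      _ = _ := by rw [this]
  have hmax := Complex.norm_le_of_forall_mem_frontier_norm_le (f := fun z => p z • g z)
    (U := Metric.ball c t) (C := t * (C * (‖c‖ + t + 1))) (z := c) Metric.isBounded_ball
    ((hp.differentiableOn.smul hg).diffContOnCl_ball subset_rfl) ?_
    (subset_closure (Metric.mem_ball_self ht))
  · have hpc : ‖p c‖ = ‖c‖ * t ^ 2 := by simp [p]
    rw [norm_smul, hpc] at hmax
    have : t * (‖c‖ * t * ‖g c‖) ≤ t * (C * (‖c‖ + t + 1)) := by
      calc _ = ‖c‖ * t ^ 2 * ‖g c‖ := by ring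
        _ ≤ _ := hmax
    exact le_of_mul_le_mul_left this ht
  · intro z hz
    rw [frontier_ball _ ht.ne'] at hz
    rw [norm_smul, hpn z hz, mul_assoc]
    refine mul_le_mul_of_nonneg_left ?_ ht.le
    by_cases h1 : ‖z‖ = 1
    · simp only [h1, one_pow, sub_self, abs_zero, zero_mul]
      positivity
    · have h1' : 0 < |1 - ‖z‖| := abs_pos.2 (sub_ne_zero.2 (Ne.symm h1))
      calc |‖z‖ ^ 2 - 1| * ‖g z‖ ≤ |‖z‖ ^ 2 - 1| * (C / |1 - ‖z‖|) := by
            gcongr; exact hC z h1 hz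
        _ = C * (‖z‖ + 1) := by
            rw [show ‖z‖ ^ 2 - 1 = -((1 - ‖z‖) * (‖z‖ + 1)) by ring, abs_neg, abs_mul,
              abs_of_nonneg (by positivity : 0 ≤ ‖z‖ + 1)]
            field_simp
        _ ≤ _ := by
            gcongr
            exact hle z hz

/-- Without isolated points the set would be perfect and contain an injective image of Cantor space,
which is uncountable. -/
theorem exists_isolated_point_of_countable {K : Set ℂ} (hK : K.Countable) (hc : IsClosed K)
    (hne : K.Nonempty) : ∃ c ∈ K, ∀ᶠ z in 𝓝[≠] c, z ∉ K := by
  by_contra! h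
  have hperf : Perfect K := by
    refine ⟨hc, fun c hcK => ?_⟩
    rw [accPt_iff_frequently_nhdsNE]
    simpa using h c hcK
  obtain ⟨f, hf, -, hinj⟩ := hperf.exists_nat_bool_injection hne
  have h1 : (Set.range f).Countable := hK.mono hf
  have : Countable (ℕ → Bool) := by
    have := h1.to_subtype
    exact (Equiv.ofInjective f hinj).countable_iff.2 this
  have hle : Cardinal.mk (ℕ → Bool) ≤ Cardinal.aleph0 := Cardinal.mk_le_aleph0
  rw [show Cardinal.mk (ℕ → Bool) = 2 ^ Cardinal.aleph0 by
    rw [← Cardinal.power_def, Cardinal.mk_bool, Cardinal.mk_nat]] at hle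
  exact (Cardinal.cantor Cardinal.aleph0).not_ge hle

/-- Countably many singularities on the unit circle are removable for a function of growth
`C / |1 - ‖z‖|` with vanishing radial residues, and such a function is zero. -/
theorem eq_zero_of_countable_singularities {E : Type*} [NormedAddCommGroup E] [NormedSpace ℂ E]
    [CompleteSpace E] {K : Set ℂ} (hK : K.Countable) (hKc : IsClosed K)
    (hKs : ∀ z ∈ K, ‖z‖ = 1) {F : ℂ → E} (hF : DifferentiableOn ℂ F Kᶜ) {C : ℝ} (hC0 : 0 ≤ C)
    (hC : ∀ z : ℂ, ‖z‖ ≠ 1 → ‖F z‖ ≤ C / |1 - ‖z‖|)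
    (hres : ∀ c ∈ K, ∀ L, Tendsto (fun r : ℝ => ((r : ℂ) * c - c) • F (r * c)) (𝓝[>] 1) (𝓝 L) →
      L = 0) {z : ℂ} (hz : z ∉ K) : F z = 0 := by
  have hdense : Dense Kᶜ := hK.dense_compl ℂ
  have hne : ∀ z, (𝓝[Kᶜ] z).NeBot := fun z => mem_closure_iff_nhdsWithin_neBot.1 (hdense z)
  -- the maximal holomorphic extension of `F`
  set G : ℂ → E := fun z => limUnder (𝓝[Kᶜ] z) F
  -- `Kᶜ` is dense, so a local continuation is determined by `F`; all of them glue to `G`.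
  let V : Set ℂ := {z | ∃ g : ℂ → E, AnalyticAt ℂ g z ∧ ∀ᶠ u in 𝓝[Kᶜ] z, g u = F u}
  have hGg : ∀ (z : ℂ) (g : ℂ → E), ContinuousAt g z → (∀ᶠ u in 𝓝[Kᶜ] z, g u = F u) →
      G z = g z := by
    intro z g hg hgF
    have := hne z
    exact ((hg.tendsto.mono_left nhdsWithin_le_nhds).congr' hgF).limUnder_eq
  have hev : ∀ (z : ℂ) (g : ℂ → E), AnalyticAt ℂ g z → (∀ᶠ u in 𝓝[Kᶜ] z, g u = F u) →
      ∀ᶠ u in 𝓝 z, AnalyticAt ℂ g u ∧ ∀ᶠ v in 𝓝[Kᶜ] u, g v = F v := by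
    intro z g hg hgF
    have h2 := eventually_eventually_nhds.2 (eventually_nhdsWithin_iff.1 hgF)
    filter_upwards [hg.eventually_analyticAt, h2] with u hu1 hu2
    exact ⟨hu1, eventually_nhdsWithin_iff.2 hu2⟩
  have hVopen : IsOpen V := by
    rw [isOpen_iff_mem_nhds]
    rintro z ⟨g, hg, hgF⟩
    filter_upwards [hev z g hg hgF] with u hu using ⟨g, hu⟩
  have hGV : ∀ z ∈ V, AnalyticAt ℂ G z := by
    rintro z ⟨g, hg, hgF⟩
    refine hg.congr ?_
    filter_upwards [hev z g hg hgF] with u hu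
    exact (hGg u g hu.1.continuousAt hu.2).symm
  have hGF : ∀ z ∉ K, G z = F z := by
    intro z hz
    exact hGg z F ((hF z hz).differentiableAt (hKc.isOpen_compl.mem_nhds hz)).continuousAt
      (Eventually.of_forall fun _ => rfl)
  have hKV : Kᶜ ⊆ V := by
    intro z hz
    exact ⟨F, hF.analyticAt (hKc.isOpen_compl.mem_nhds hz), Eventually.of_forall fun _ => rfl⟩
  have hGC : ∀ z : ℂ, ‖z‖ ≠ 1 → ‖G z‖ ≤ C / |1 - ‖z‖| := by
    intro z hz
    rw [hGF z fun h => hz (hKs z h)]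
    exact hC z hz
  -- The isolated point is taken in `Vᶜ`, not in `K`: points of `K` that accumulate at it have
  -- already been continued across.
  have hVuniv : V = Set.univ := by
    by_contra hV
    have hVK : Vᶜ ⊆ K := Set.compl_subset_comm.1 hKV
    obtain ⟨c, hcV, hc⟩ := exists_isolated_point_of_countable (hK.mono hVK)
      hVopen.isClosed_compl (by simpa [Set.nonempty_compl] using hV)
    have hcK : c ∈ K := hVK hcV
    have hc1 : ‖c‖ = 1 := hKs c hcK
    replace hc : ∀ᶠ z in 𝓝[≠] c, z ∈ V := by simpa using hc
    have hdiff : ∀ᶠ z in 𝓝[≠] c, DifferentiableAt ℂ G z := by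
      filter_upwards [hc] with z hz using (hGV z hz).differentiableAt
    obtain ⟨ρ, hρ, hρV⟩ := Metric.eventually_nhds_iff_ball.1 (eventually_nhdsWithin_iff.1 hc)
    -- at most a simple pole
    have hpole : ∀ᶠ z in 𝓝[≠] c, ‖(z - c) • G z‖ ≤ 20 * C := by
      have hball : Metric.ball c (min (ρ / 2) (1 / 2)) ∈ 𝓝[≠] c :=
        mem_nhdsWithin_of_mem_nhds (Metric.ball_mem_nhds c (by positivity))
      filter_upwards [hball, self_mem_nhdsWithin] with z hz hzc
      have hzc' : 0 < ‖z - c‖ := norm_pos_iff.2 (sub_ne_zero.2 hzc)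
      rw [Metric.mem_ball, dist_eq_norm, lt_min_iff] at hz
      have hz1 : 1 / 2 ≤ ‖z‖ := by
        have := norm_sub_norm_le c z
        rw [norm_sub_rev, hc1] at this
        linarith
      have hz2 : ‖z‖ ≤ 3 / 2 := by
        have := norm_sub_norm_le z c
        rw [hc1] at this
        linarith
      -- Half the distance to `c` keeps the disc off `c`, although it may cross the unit circle.
      have key := Complex.norm_mul_le_of_sphere_bound (g := G) (c := z) (t := ‖z - c‖ / 2)
        (by positivity) hC0 ?_ (fun u hu _ => hGC u hu)
      · rw [norm_smul]
        have h1 : ‖z‖ * (‖z - c‖ / 2) * ‖G z‖ ≥ (1 / 2) * (‖z - c‖ / 2) * ‖G z‖ := by gcongr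
        have h2 : C * (‖z‖ + ‖z - c‖ / 2 + 1) ≤ C * (3 / 2 + 1 / 4 + 1) := by
          exact mul_le_mul_of_nonneg_left (by linarith [hz.2]) hC0
        have h3 : 1 / 4 * (‖z - c‖ * ‖G z‖) ≤ 11 / 4 * C := by
          calc _ = (1 / 2) * (‖z - c‖ / 2) * ‖G z‖ := by ring
            _ ≤ _ := h1.le.trans (key.trans h2)
            _ = _ := by ring
        linarith
      · intro u hu
        rw [Metric.mem_closedBall, dist_eq_norm] at hu
        refine (hGV u (hρV u ?_ ?_)).differentiableAt.differentiableWithinAt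
        · rw [Metric.mem_ball, dist_eq_norm]
          calc ‖u - c‖ = ‖(u - z) + (z - c)‖ := by congr 1; ring
            _ ≤ ‖u - z‖ + ‖z - c‖ := norm_add_le _ _
            _ < ρ := by linarith [hz.1]
        · rintro rfl
          rw [norm_sub_rev] at hu
          linarith
    have hlim := Complex.tendsto_limUnder_of_differentiable_on_punctured_nhds_of_bounded_under
      (f := fun z => (z - c) • G z) (c := c)
      (by filter_upwards [hdiff] with z hz; fun_prop)
      ⟨20 * C, eventually_map.2 (by filter_upwards [hpole] with z hz; simpa using hz)⟩
    set L := limUnder (𝓝[≠] c) fun z => (z - c) • G z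
    have hc0 : c ≠ 0 := by rintro rfl; simp at hc1
    have hrad : Tendsto (fun r : ℝ => (r : ℂ) * c) (𝓝[>] 1) (𝓝[≠] c) := by
      refine tendsto_nhdsWithin_iff.2 ⟨?_, ?_⟩
      · have : Continuous fun r : ℝ => (r : ℂ) * c := by fun_prop
        simpa using (this.tendsto 1).mono_left nhdsWithin_le_nhds
      · filter_upwards [self_mem_nhdsWithin] with r hr h
        have h' : (r : ℂ) * c = 1 * c := by rw [h, one_mul]
        have := mul_right_cancel₀ hc0 h'
        exact (ne_of_gt hr) (by exact_mod_cast this)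
    have hL : L = 0 := by
      refine hres c hcK L ((hlim.comp hrad).congr' ?_)
      filter_upwards [self_mem_nhdsWithin] with r hr
      have hr : (1 : ℝ) < r := hr
      have hn : ‖(r : ℂ) * c‖ ≠ 1 := by
        rw [norm_mul, hc1, mul_one, Complex.norm_real, Real.norm_eq_abs, abs_of_pos (by linarith)]
        exact hr.ne'
      simp only [Function.comp]
      rw [hGF _ fun h => hn (hKs _ h)]
    rw [hL] at hlim
    -- With zero residue, `G` is `o(1 / (z - c))`, the hypothesis of Riemann's removable singularity
    -- theorem.
    have hlittle : (fun z => G z - G c) =o[𝓝[≠] c] fun z => (z - c)⁻¹ := by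
      have h1 : G =o[𝓝[≠] c] fun z => (z - c)⁻¹ := by
        rw [Asymptotics.isLittleO_iff]
        intro ε hε
        filter_upwards [(tendsto_zero_iff_norm_tendsto_zero.1 hlim).eventually_lt_const hε,
          self_mem_nhdsWithin] with z hz hzc
        have hzc' : 0 < ‖z - c‖ := norm_pos_iff.2 (sub_ne_zero.2 hzc)
        rw [norm_smul] at hz
        rw [norm_inv, ← div_eq_mul_inv, le_div_iff₀ hzc', mul_comm]
        exact hz.le
      refine h1.sub ?_
      have h2 : IsBoundedUnder (· ≤ ·) (𝓝[≠] c) fun z => ‖(fun _ : ℂ => G c) z - G c‖ :=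
        ⟨0, by simp⟩
      rw [Asymptotics.isLittleO_const_left]
      right
      exact (tendsto_norm_inv_nhdsNE_zero_atTop).comp (by
        have : Tendsto (fun z : ℂ => z - c) (𝓝[≠] c) (𝓝[≠] 0) := by
          refine tendsto_nhdsWithin_iff.2 ⟨?_, ?_⟩
          · have : Continuous fun z : ℂ => z - c := by fun_prop
            simpa using (this.tendsto c).mono_left nhdsWithin_le_nhds
          · filter_upwards [self_mem_nhdsWithin] with z hz using sub_ne_zero.2 hz
        exact this)
    have hrem := Complex.differentiableOn_update_limUnder_insert_of_isLittleO (f := G) (c := c)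
      (s := {z | DifferentiableAt ℂ G z}) hdiff
      (fun z hz => DifferentiableAt.differentiableWithinAt hz) hlittle
    refine hcV ⟨_, hrem.analyticAt (insert_mem_nhds_iff.2 hdiff), ?_⟩
    filter_upwards [self_mem_nhdsWithin] with u hu
    rw [Function.update_of_ne (by rintro rfl; exact hu hcK), hGF u hu]
  have hdiff : Differentiable ℂ G := fun z => (hGV z (hVuniv ▸ Set.mem_univ z)).differentiableAt
  rw [← hGF z hz]
  refine hdiff.apply_eq_of_tendsto_cocompact z ?_
  have hbound : Tendsto (fun z : ℂ => C / (‖z‖ - 1)) (cocompact ℂ) (𝓝 0) :=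
    (tendsto_atTop_add_const_right _ (-1) tendsto_norm_cocompact_atTop).const_div_atTop C
  refine squeeze_zero_norm' ?_ hbound
  filter_upwards [tendsto_norm_cocompact_atTop.eventually_gt_atTop 1] with z hz
  have := hGC z hz.ne'
  rwa [abs_sub_comm, abs_of_pos (by linarith)] at this

/-! ### Weak compactness and barycentres -/

section WeakSpace

variable {X : Type*} [NormedAddCommGroup X] [NormedSpace ℂ X]

theorem WeakSpace.continuous_eval (f : X →L[ℂ] ℂ) :
    Continuous fun k : WeakSpace ℂ X => f ((toWeakSpace ℂ X).symm k) :=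
  WeakBilin.eval_continuous (topDualPairing ℂ X).flip f

theorem WeakSpace.t2Space : T2Space (WeakSpace ℂ X) := by
  have hinj : Function.Injective (topDualPairing ℂ X).flip := by
    intro x y hxy
    refine (SeparatingDual.eq_iff_forall_dual_eq (R := ℂ)).2 fun f => ?_
    exact DFunLike.congr_fun hxy f
  exact (WeakBilin.isEmbedding hinj).t2Space

theorem WeakSpace.exists_norm_le_of_isCompact {K : Set (WeakSpace ℂ X)} (hK : IsCompact K) :
    ∃ C, ∀ k ∈ K, ‖(toWeakSpace ℂ X).symm k‖ ≤ C := by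
  obtain ⟨C, hC⟩ := banach_steinhaus
    (g := fun k : K => NormedSpace.inclusionInDoubleDual ℂ X ((toWeakSpace ℂ X).symm k)) (by
      intro f
      obtain ⟨C, hC⟩ := (hK.image (WeakSpace.continuous_eval f)).isBounded.exists_norm_le
      exact ⟨C, fun k => by simpa using hC _ (Set.mem_image_of_mem _ k.2)⟩)
  refine ⟨C, fun k hk => ?_⟩
  have := hC ⟨k, hk⟩
  exact ((NormedSpace.inclusionInDoubleDualLi (E := X) ℂ).norm_map _).symm.le.trans this

theorem WeakSpace.isClosed_image_of_convex {s : Set X} (hs : Convex ℝ s) (hc : IsClosed s) :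
    IsClosed (toWeakSpace ℂ X '' s) := by
  have h := hs.toWeakSpace_closure ℂ
  rw [hc.closure_eq] at h
  exact closure_eq_iff_isClosed.1 h.symm

-- Norm-closed balls are convex, hence weakly closed, and in the separable space `S` every open set
-- is a countable union of closed balls. So weak Borel sets suffice for norm measurability.
open MeasureTheory in
theorem WeakSpace.stronglyMeasurable_coe
    {K : Set (WeakSpace ℂ X)} [MeasurableSpace K] [BorelSpace K]
    {S : Submodule ℂ X} (hS : TopologicalSpace.IsSeparable (S : Set X))
    (hKS : ∀ k ∈ K, (toWeakSpace ℂ X).symm k ∈ S) :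
    StronglyMeasurable fun k : K => (toWeakSpace ℂ X).symm k := by
  have : TopologicalSpace.SeparableSpace S := hS.separableSpace
  have : SecondCountableTopology S := UniformSpace.secondCountable_of_separable S
  borelize ↥S
  let j : K → S := fun k => ⟨(toWeakSpace ℂ X).symm k, hKS k k.2⟩
  have hj : Measurable j := by
    refine measurable_of_isOpen fun U hU => ?_
    have hr : ∀ u : S, ∃ r > 0, u ∈ U → Metric.closedBall u r ⊆ U := by
      intro u
      by_cases hu : u ∈ U
      · obtain ⟨r, hr, h⟩ := Metric.nhds_basis_closedBall.mem_iff.1 (hU.mem_nhds hu)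
        exact ⟨r, hr, fun _ => h⟩
      · exact ⟨1, one_pos, fun h => absurd h hu⟩
    choose r hr0 hr using hr
    obtain ⟨t, htU, htc, hUt⟩ := TopologicalSpace.countable_cover_nhdsWithin
      (s := U) (f := fun u => Metric.closedBall u (r u))
      fun u _ => mem_nhdsWithin_of_mem_nhds (Metric.closedBall_mem_nhds u (hr0 u))
    have hUeq : U = ⋃ u ∈ t, Metric.closedBall u (r u) :=
      hUt.antisymm (Set.iUnion₂_subset fun u hu => hr u (htU hu))
    rw [hUeq, Set.preimage_iUnion₂]
    refine MeasurableSet.biUnion htc fun u _ => IsClosed.measurableSet ?_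
    convert (WeakSpace.isClosed_image_of_convex (convex_closedBall (u : X) (r u))
      Metric.isClosed_closedBall).preimage (continuous_subtype_val (p := fun k => k ∈ K)) using 1
    ext k
    rw [Set.mem_preimage, Set.mem_preimage, LinearEquiv.image_eq_preimage_symm]
    rfl
  exact S.subtypeL.continuous.comp_stronglyMeasurable hj.stronglyMeasurable

open MeasureTheory in
/-- Averages of a sequence with relatively weakly compact range have weak limits along
ultrafilters. -/
theorem exists_weak_limit_of_averages [CompleteSpace X] {x : ℕ → X}
    (hx : IsCompact (closure (Set.range fun n => toWeakSpace ℂ X (x n))))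
    {ι : Type*} (U : Ultrafilter ι) (P : ι → Measure ℕ) [∀ i, IsProbabilityMeasure (P i)] :
    ∃ y : X, ∀ f : X →L[ℂ] ℂ, Tendsto (fun i => f (∫ n, x n ∂P i)) U (𝓝 (f y)) := by
  set K := closure (Set.range fun n => toWeakSpace ℂ X (x n))
  have : T2Space (WeakSpace ℂ X) := WeakSpace.t2Space
  have : CompactSpace K := isCompact_iff_compactSpace.1 hx
  borelize ↥K
  let S : Submodule ℂ X := (Submodule.span ℂ (Set.range x)).topologicalClosure
  have hS : TopologicalSpace.IsSeparable (S : Set X) :=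
    ((Set.countable_range x).isSeparable.span (R := ℂ)).closure
  have hKS : ∀ k ∈ K, (toWeakSpace ℂ X).symm k ∈ S := by
    have h1 : K ⊆ toWeakSpace ℂ X '' (S : Set X) := by
      refine closure_minimal ?_ (WeakSpace.isClosed_image_of_convex
        (S.restrictScalars ℝ).convex (Submodule.isClosed_topologicalClosure _))
      rintro _ ⟨n, rfl⟩
      exact Set.mem_image_of_mem _
        (Submodule.le_topologicalClosure _ (Submodule.subset_span (Set.mem_range_self n)))
    intro k hk
    obtain ⟨s, hs, rfl⟩ := h1 hk
    simpa using hs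
  obtain ⟨C, hC⟩ := WeakSpace.exists_norm_le_of_isCompact hx
  have hint : ∀ (μ : Measure K) [IsFiniteMeasure μ],
      Integrable (fun k : K => (toWeakSpace ℂ X).symm k) μ := fun μ _ =>
    Integrable.of_bound (WeakSpace.stronglyMeasurable_coe hS hKS).aestronglyMeasurable C
      (Eventually.of_forall fun k => hC k k.2)
  let κ : ℕ → K := fun n => ⟨toWeakSpace ℂ X (x n), subset_closure (Set.mem_range_self n)⟩
  have hκ : Measurable κ := measurable_of_countable κ
  let μ : ι → ProbabilityMeasure K := fun i =>
    ⟨(P i).map κ, Measure.isProbabilityMeasure_map hκ.aemeasurable⟩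
  -- Probability measures on the compact space `K` form a compact space; the barycentre of the limit
  -- measure is the required weak limit.
  obtain ⟨ν, -, hν⟩ := isCompact_univ.ultrafilter_le_nhds' (U.map μ) Filter.univ_mem
  refine ⟨∫ k, (toWeakSpace ℂ X).symm k ∂(ν : Measure K), fun f => ?_⟩
  let fb : BoundedContinuousFunction K ℂ := BoundedContinuousFunction.mkOfCompact
    ⟨fun k => f ((toWeakSpace ℂ X).symm k),
      (WeakSpace.continuous_eval f).comp continuous_subtype_val⟩
  have hf : ∀ μ : ProbabilityMeasure K,
      f (∫ k, (toWeakSpace ℂ X).symm k ∂(μ : Measure K)) = ∫ k, fb k ∂(μ : Measure K) :=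
    fun μ => (f.integral_comp_comm (hint μ)).symm
  have hμ : ∀ i, ∫ n, x n ∂P i = ∫ k, (toWeakSpace ℂ X).symm k ∂(μ i : Measure K) := by
    intro i
    exact (integral_map hκ.aemeasurable
      (WeakSpace.stronglyMeasurable_coe hS hKS).aestronglyMeasurable).symm
  simp only [hμ, hf]
  exact (ProbabilityMeasure.tendsto_iff_forall_integral_rclike_tendsto ℂ).1
    (show Tendsto μ U (𝓝 ν) from hν) fb

end WeakSpace

/-! ### Bounded sequences modulo null sequences -/

section LimitSpace

open scoped BoundedContinuousFunction

variable (E : Type*) [NormedAddCommGroup E] [NormedSpace ℂ E]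

/-- The subspace of null sequences in the space of bounded sequences. -/
noncomputable def nullSequences : Submodule ℂ (ℕ →ᵇ E) where
  carrier := {u | Tendsto u atTop (𝓝 0)}
  zero_mem' := tendsto_const_nhds
  add_mem' := by
    intro u v hu hv
    have h := Filter.Tendsto.add (show Tendsto u atTop (𝓝 0) from hu)
      (show Tendsto v atTop (𝓝 0) from hv)
    rw [add_zero] at h
    exact h
  smul_mem' := by
    intro c u hu
    have h := Filter.Tendsto.const_smul (show Tendsto u atTop (𝓝 0) from hu) c
    rw [smul_zero] at h
    exact h

variable {E}

theorem mem_nullSequences {u : ℕ →ᵇ E} : u ∈ nullSequences E ↔ Tendsto u atTop (𝓝 0) := Iff.rfl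

instance isClosed_nullSequences : IsClosed (nullSequences E : Set (ℕ →ᵇ E)) := by
  refine isClosed_of_closure_subset fun u hu => ?_
  refine Metric.tendsto_atTop.2 fun ε hε => ?_
  obtain ⟨v, hv, huv⟩ := Metric.mem_closure_iff.1 hu (ε / 2) (half_pos hε)
  obtain ⟨N, hN⟩ := Metric.tendsto_atTop.1 (mem_nullSequences.1 hv) (ε / 2) (half_pos hε)
  refine ⟨N, fun n hn => ?_⟩
  calc dist (u n) 0 ≤ dist (u n) (v n) + dist (v n) 0 := dist_triangle _ _ _
    _ < ε / 2 + ε / 2 :=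
        add_lt_add ((BoundedContinuousFunction.dist_coe_le_dist n).trans_lt huv) (hN n hn)
    _ = ε := add_halves ε

variable (E) in
/-- Bounded sequences modulo null sequences. -/
abbrev LimitSpace := (ℕ →ᵇ E) ⧸ nullSequences E

/-- Reindexing of bounded sequences. -/
noncomputable def reindexSequences (s : ℕ → ℕ) : (ℕ →ᵇ E) →ₗ[ℂ] (ℕ →ᵇ E) where
  toFun u := u.compContinuous ⟨s, continuous_of_discreteTopology⟩
  map_add' _ _ := rfl
  map_smul' _ _ := rfl

theorem norm_reindexSequences_le (s : ℕ → ℕ) (u : ℕ →ᵇ E) : ‖reindexSequences s u‖ ≤ ‖u‖ :=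
  (BoundedContinuousFunction.norm_le (norm_nonneg u)).2 fun n => u.norm_coe_le_norm (s n)

/-- The action on the limit space of a reindexing tending to infinity. -/
noncomputable def LimitSpace.reindex (s : ℕ → ℕ) (hs : Tendsto s atTop atTop) :
    LimitSpace E →ₗ[ℂ] LimitSpace E :=
  Submodule.mapQ _ _ (reindexSequences s) fun _ hu => (mem_nullSequences.1 hu).comp hs

theorem LimitSpace.norm_reindex_le (s : ℕ → ℕ) (hs : Tendsto s atTop atTop) (q : LimitSpace E) :
    ‖LimitSpace.reindex s hs q‖ ≤ ‖q‖ := by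
  refine le_of_forall_pos_lt_add fun ε hε => ?_
  obtain ⟨u, rfl, hu⟩ := Submodule.Quotient.norm_mk_lt q hε
  exact ((Submodule.Quotient.norm_mk_le _ _).trans (norm_reindexSequences_le s u)).trans_lt hu

theorem LimitSpace.reindex_reindex (s t : ℕ → ℕ) (hs : Tendsto s atTop atTop)
    (ht : Tendsto t atTop atTop) (h : ∀ᶠ n in atTop, s (t n) = n) (q : LimitSpace E) :
    LimitSpace.reindex t ht (LimitSpace.reindex s hs q) = q := by
  obtain ⟨u, rfl⟩ := Submodule.Quotient.mk_surjective _ q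
  refine (Submodule.Quotient.eq _).2 ?_
  refine mem_nullSequences.2 (tendsto_const_nhds.congr' ?_)
  filter_upwards [h] with n hn
  change 0 = u (s (t n)) - u n
  rw [hn, sub_self]

variable (E) in
/-- The shift, an invertible isometry of the limit space. -/
noncomputable def LimitSpace.shift : LimitSpace E ≃ₗᵢ[ℂ] LimitSpace E where
  toLinearEquiv := LinearEquiv.ofLinearMap
    (LimitSpace.reindex (fun n => n + 1) (tendsto_add_atTop_nat 1))
    -- Truncated subtraction spoils only the entry at `0`, which is invisible modulo null sequences.
    (LimitSpace.reindex (fun n => n - 1) (tendsto_sub_atTop_nat 1))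
    (LinearMap.ext fun q => LimitSpace.reindex_reindex (fun n => n - 1) (fun n => n + 1)
      (tendsto_sub_atTop_nat 1) (tendsto_add_atTop_nat 1)
      (Eventually.of_forall fun n => Nat.add_sub_cancel n 1) q)
    (LinearMap.ext fun q => LimitSpace.reindex_reindex (fun n => n + 1) (fun n => n - 1)
      (tendsto_add_atTop_nat 1) (tendsto_sub_atTop_nat 1)
      ((eventually_ge_atTop 1).mono fun n hn => Nat.sub_add_cancel hn) q)
  norm_map' q := by
    refine le_antisymm (LimitSpace.norm_reindex_le _ (tendsto_add_atTop_nat 1) q) ?_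
    have := LimitSpace.norm_reindex_le (fun n => n - 1) (tendsto_sub_atTop_nat 1)
      (LimitSpace.reindex (fun n => n + 1) (tendsto_add_atTop_nat 1) q)
    rwa [LimitSpace.reindex_reindex (fun n => n + 1) (fun n => n - 1)
      (tendsto_add_atTop_nat 1) (tendsto_sub_atTop_nat 1)
      ((eventually_ge_atTop 1).mono fun n hn => Nat.sub_add_cancel hn) q] at this

variable {X : Type*} [NormedAddCommGroup X] [NormedSpace ℂ X]

/-- A uniformly bounded sequence of operators, as an operator into bounded sequences. -/
noncomputable def boundedSequenceMap (A : ℕ → X →L[ℂ] E) (M : ℝ) (hA : ∀ n x, ‖A n x‖ ≤ M * ‖x‖) :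
    X →ₗ[ℂ] (ℕ →ᵇ E) where
  toFun x := BoundedContinuousFunction.ofNormedAddCommGroupDiscrete (fun n => A n x) (M * ‖x‖)
    fun n => hA n x
  map_add' x y := by ext n; exact map_add (A n) x y
  map_smul' c x := by ext n; exact map_smul (A n) c x

/-- A uniformly bounded sequence of operators, as an operator into the limit space. -/
noncomputable def limitMap (A : ℕ → X →L[ℂ] E) (M : ℝ) (hM : 0 ≤ M) (hA : ∀ n x, ‖A n x‖ ≤ M * ‖x‖) :
    X →L[ℂ] LimitSpace E :=
  ((nullSequences E).mkQ ∘ₗ boundedSequenceMap A M hA).mkContinuous M fun x =>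
    (Submodule.Quotient.norm_mk_le _ _).trans
      ((BoundedContinuousFunction.norm_le (by positivity)).2 fun n => hA n x)

theorem limitMap_eq_zero_iff (A : ℕ → X →L[ℂ] E) (M : ℝ) (hM : 0 ≤ M)
    (hA : ∀ n x, ‖A n x‖ ≤ M * ‖x‖) (x : X) :
    limitMap A M hM hA x = 0 ↔ Tendsto (fun n => A n x) atTop (𝓝 0) :=
  Submodule.Quotient.mk_eq_zero _

theorem limitMap_shift (A : ℕ → X →L[ℂ] E) (M : ℝ) (hM : 0 ≤ M)
    (hA : ∀ n x, ‖A n x‖ ≤ M * ‖x‖) {T : X →L[ℂ] X} (hT : ∀ n x, A n (T x) = A (n + 1) x) (x : X) :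
    limitMap A M hM hA (T x) = LimitSpace.shift E (limitMap A M hM hA x) := by
  have h : boundedSequenceMap A M hA (T x) =
      reindexSequences (fun n => n + 1) (boundedSequenceMap A M hA x) := by
    ext n
    exact hT n x
  exact congrArg (nullSequences E).mkQ h

end LimitSpace

/-! ### Resolvents of isometries and of power-bounded operators -/

section Resolvent

variable {X : Type*} [NormedAddCommGroup X] [NormedSpace ℂ X]

theorem resolvent_apply_sub {T : X →L[ℂ] X} {z : ℂ} (hz : z ∈ resolventSet ℂ T) (x : X) :
    resolvent T z (z • x - T x) = x := by
  have h := Ring.inverse_mul_cancel _ (spectrum.mem_resolventSet_iff.1 hz)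
  simpa [resolvent, Algebra.algebraMap_eq_smul_one] using DFunLike.congr_fun h x

theorem sub_resolvent_apply {T : X →L[ℂ] X} {z : ℂ} (hz : z ∈ resolventSet ℂ T) (x : X) :
    z • resolvent T z x - T (resolvent T z x) = x := by
  have h := Ring.mul_inverse_cancel _ (spectrum.mem_resolventSet_iff.1 hz)
  simpa [resolvent, Algebra.algebraMap_eq_smul_one] using DFunLike.congr_fun h x

variable [CompleteSpace X]

/-- Inside the disc, `z - S = -S (1 - z S⁻¹)` with `‖z S⁻¹‖ < 1`; outside, `‖z‖` exceeds `‖S‖`. -/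
theorem LinearIsometryEquiv.mem_resolventSet (S : X ≃ₗᵢ[ℂ] X) {z : ℂ} (hz : ‖z‖ ≠ 1) :
    z ∈ resolventSet ℂ (S.toContinuousLinearEquiv : X →L[ℂ] X) := by
  rcases hz.lt_or_gt with h | h
  · have hu : ‖z • (S.symm.toContinuousLinearEquiv : X →L[ℂ] X)‖ < 1 := by
      have : ‖(S.symm.toContinuousLinearEquiv : X →L[ℂ] X)‖ ≤ 1 :=
        ContinuousLinearMap.opNorm_le_bound _ zero_le_one fun x => by simp
      rw [norm_smul]
      nlinarith [norm_nonneg z]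
    have h2 := ((ContinuousLinearEquiv.toUnit S.toContinuousLinearEquiv).isUnit.mul
      (Units.oneSub _ hu).isUnit).neg
    have heq : algebraMap ℂ (X →L[ℂ] X) z - (S.toContinuousLinearEquiv : X →L[ℂ] X) =
        -((ContinuousLinearEquiv.toUnit S.toContinuousLinearEquiv : X →L[ℂ] X) *
          (Units.oneSub _ hu : X →L[ℂ] X)) := by
      ext x
      change z • x - S x = -(S (x - z • S.symm x))
      simp
    rw [spectrum.mem_resolventSet_iff, heq]
    exact h2
  · by_contra hmem
    have h1 := spectrum.norm_le_norm_mul_of_mem (𝕜 := ℂ) hmem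
    have h2 : ‖(S.toContinuousLinearEquiv : X →L[ℂ] X)‖ ≤ 1 :=
      ContinuousLinearMap.opNorm_le_bound _ zero_le_one fun x => by simp
    have h3 : ‖(1 : X →L[ℂ] X)‖ ≤ 1 := ContinuousLinearMap.norm_id_le
    have := mul_le_mul h2 h3 (norm_nonneg _) zero_le_one
    linarith

theorem LinearIsometryEquiv.norm_resolvent_apply_le (S : X ≃ₗᵢ[ℂ] X) {z : ℂ} (hz : ‖z‖ ≠ 1) (x : X) :
    ‖resolvent (S.toContinuousLinearEquiv : X →L[ℂ] X) z x‖ ≤ ‖x‖ / |1 - ‖z‖| := by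
  have h := sub_resolvent_apply (S.mem_resolventSet hz) x
  set y := resolvent (S.toContinuousLinearEquiv : X →L[ℂ] X) z x
  have hS : ‖(S.toContinuousLinearEquiv : X →L[ℂ] X) y‖ = ‖y‖ := S.norm_map y
  rw [le_div_iff₀ (abs_pos.2 (sub_ne_zero.2 hz.symm)), mul_comm]
  calc |1 - ‖z‖| * ‖y‖ = |‖z • y‖ - ‖(S.toContinuousLinearEquiv : X →L[ℂ] X) y‖| := by
        rw [hS, norm_smul, ← sub_one_mul, abs_mul, abs_norm, abs_sub_comm]
    _ ≤ ‖z • y - (S.toContinuousLinearEquiv : X →L[ℂ] X) y‖ := abs_norm_sub_norm_le _ _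
    _ = ‖x‖ := by rw [h]

theorem mem_resolventSet_of_power_bounded {T : X →L[ℂ] X} {M : ℝ}
    (hM : ∀ n x, ‖(T ^ n) x‖ ≤ M * ‖x‖) {z : ℂ} (hz : 1 < ‖z‖) : z ∈ resolventSet ℂ T := by
  by_contra hmem
  have hM0 : 0 ≤ |M| := abs_nonneg M
  have hb : ∀ n : ℕ, ‖z‖ ^ n ≤ |M| * 1 := by
    intro n
    have h1 := spectrum.norm_le_norm_mul_of_mem (𝕜 := ℂ) (spectrum.pow_mem_pow T n hmem)
    rw [norm_pow] at h1
    refine h1.trans (mul_le_mul ?_ ContinuousLinearMap.norm_id_le (norm_nonneg _) hM0)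
    exact ContinuousLinearMap.opNorm_le_bound _ hM0 fun x =>
      (hM n x).trans (mul_le_mul_of_nonneg_right (le_abs_self M) (norm_nonneg x))
  obtain ⟨n, hn⟩ := pow_unbounded_of_one_lt (|M| * 1) hz
  exact (hb n).not_gt hn

end Resolvent

/-! ### Countable peripheral spectrum and intertwining operators -/

section Tauberian

variable {X Q : Type*} [NormedAddCommGroup X] [NormedSpace ℂ X] [CompleteSpace X]
  [NormedAddCommGroup Q] [NormedSpace ℂ Q] [CompleteSpace Q]

/-- An operator intertwining `T` with an invertible isometry kills every vector whose radial
residues vanish, if `T` has countable peripheral spectrum. -/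
theorem map_eq_zero_of_intertwining {T : X →L[ℂ] X} (S : Q ≃ₗᵢ[ℂ] Q) (J : X →L[ℂ] Q)
    (hJ : ∀ x, J (T x) = S (J x))
    (hσ : (spectrum ℂ T ∩ Metric.sphere (0 : ℂ) 1).Countable)
    {x : X} (hres : ∀ c : ℂ, ‖c‖ = 1 → ∀ L, Tendsto
      (fun r : ℝ => J (((r : ℂ) * c - c) • resolvent T ((r : ℂ) * c) x)) (𝓝[>] 1) (𝓝 L) → L = 0)
    (hT : ∀ z : ℂ, 1 < ‖z‖ → z ∈ resolventSet ℂ T) : J x = 0 := by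
  set S' : Q →L[ℂ] Q := (S.toContinuousLinearEquiv : Q →L[ℂ] Q)
  set K := spectrum ℂ T ∩ Metric.sphere (0 : ℂ) 1
  have hKs : ∀ z ∈ K, ‖z‖ = 1 := fun z hz => by simpa using hz.2
  have hKc : IsClosed K := (spectrum.isClosed T).inter Metric.isClosed_sphere
  have hagree : ∀ z : ℂ, ‖z‖ ≠ 1 → z ∈ resolventSet ℂ T →
      resolvent S' z (J x) = J (resolvent T z x) := by
    intro z hz hzT
    conv_lhs => rw [← sub_resolvent_apply hzT x, map_sub, map_smul, hJ]
    exact resolvent_apply_sub (S.mem_resolventSet hz) _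
  -- By `hagree` the two formulas coincide off the circle wherever both resolvents exist, so `F` is
  -- holomorphic off `K`.
  let F : ℂ → Q := fun z => if ‖z‖ = 1 then J (resolvent T z x) else resolvent S' z (J x)
  have hF1 : ∀ z ∈ resolventSet ℂ T, F z = J (resolvent T z x) := by
    intro z hz
    by_cases h : ‖z‖ = 1
    · simp only [F, if_pos h]
    · simp only [F, if_neg h, hagree z h hz]
  have hF2 : ∀ z : ℂ, ‖z‖ ≠ 1 → F z = resolvent S' z (J x) := fun z h => if_neg h
  have hF : DifferentiableOn ℂ F Kᶜ := by
    intro z hz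
    refine DifferentiableAt.differentiableWithinAt ?_
    by_cases h : ‖z‖ = 1
    · have hzT : z ∈ resolventSet ℂ T := by
        by_contra hn
        exact hz ⟨hn, by simpa using h⟩
      have h1 : DifferentiableAt ℂ (fun z => J (resolvent T z x)) z :=
        J.differentiableAt.comp z
          ((spectrum.hasDerivAt_resolvent_const_left hzT).differentiableAt.clm_apply
            (differentiableAt_const x))
      refine h1.congr_of_eventuallyEq ?_
      filter_upwards [(spectrum.isOpen_resolventSet T).mem_nhds hzT] with u hu using hF1 u hu
    · have h1 : DifferentiableAt ℂ (fun z => resolvent S' z (J x)) z :=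
        (spectrum.hasDerivAt_resolvent_const_left
          (S.mem_resolventSet h)).differentiableAt.clm_apply (differentiableAt_const _)
      refine h1.congr_of_eventuallyEq ?_
      filter_upwards [(isOpen_ne.preimage continuous_norm).mem_nhds h] with u hu using hF2 u hu
  have h2 : ‖(2 : ℂ)‖ ≠ 1 := by norm_num
  have hzero : F 2 = 0 := by
    refine eq_zero_of_countable_singularities hσ hKc hKs hF (norm_nonneg (J x)) ?_ ?_
      fun h => h2 (hKs 2 h)
    · intro z hz
      rw [hF2 z hz]
      exact S.norm_resolvent_apply_le hz _
    · intro c hc L hL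
      refine hres c (hKs c hc) L (hL.congr' ?_)
      filter_upwards [self_mem_nhdsWithin] with r hr
      have hr : (1 : ℝ) < r := hr
      have hn : 1 < ‖(r : ℂ) * c‖ := by
        rw [norm_mul, hKs c hc, mul_one, Complex.norm_real, Real.norm_eq_abs,
          abs_of_pos (by linarith)]
        exact hr
      rw [hF1 _ (hT _ hn), map_smul]
  rw [hF2 2 h2] at hzero
  have := sub_resolvent_apply (S.mem_resolventSet h2) (J x)
  rw [hzero] at this
  simpa using this.symm

end Tauberian

/-! ### Abel means and residues -/

section Ergodic

open MeasureTheory ProbabilityTheory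

variable {X : Type*} [NormedAddCommGroup X] [NormedSpace ℂ X] [CompleteSpace X]

theorem IsWeaklyAlmostPeriodicOp.exists_power_bound {T : X →L[ℂ] X}
    (hT : IsWeaklyAlmostPeriodicOp T) : ∃ M, 0 ≤ M ∧ ∀ n x, ‖(T ^ n) x‖ ≤ M * ‖x‖ := by
  obtain ⟨M, hM⟩ := banach_steinhaus (g := fun n : ℕ => T ^ n) fun x => by
    obtain ⟨C, hC⟩ := WeakSpace.exists_norm_le_of_isCompact (hT x)
    exact ⟨C, fun n => hC _ (subset_closure (Set.mem_range_self n))⟩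
  exact ⟨M, (norm_nonneg _).trans (hM 0), fun n x => (T ^ n).le_of_opNorm_le (hM n) x⟩

omit [CompleteSpace X] in
theorem isCompact_closure_rotated_orbit {T : X →L[ℂ] X} (hT : IsWeaklyAlmostPeriodicOp T)
    {c : ℂ} (hc : ‖c‖ = 1) (x : X) :
    IsCompact (closure (Set.range fun n : ℕ => toWeakSpace ℂ X (c⁻¹ ^ n • (T ^ n) x))) := by
  have : T2Space (WeakSpace ℂ X) := WeakSpace.t2Space
  have hK : IsCompact ((fun p : ℂ × WeakSpace ℂ X => p.1 • p.2) ''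
      (Metric.sphere (0 : ℂ) 1 ×ˢ
        closure (Set.range fun n : ℕ => toWeakSpace ℂ X ((T ^ n) x)))) :=
    ((isCompact_sphere _ _).prod (hT x)).image continuous_smul
  refine hK.closure_of_subset ?_
  rintro _ ⟨n, rfl⟩
  exact ⟨(c⁻¹ ^ n, toWeakSpace ℂ X ((T ^ n) x)),
    ⟨by simp [hc], subset_closure (Set.mem_range_self n)⟩, by simp⟩

/-- The success probability `1 - 1 / r` of the geometric law giving the Abel means. -/
noncomputable def abelParameter (r : ℝ) : unitInterval := Set.projIcc 0 1 zero_le_one (1 - r⁻¹)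

theorem coe_abelParameter {r : ℝ} (hr : 1 < r) : (abelParameter r : ℝ) = 1 - r⁻¹ := by
  have h1 : r⁻¹ ≤ 1 := inv_le_one_of_one_le₀ hr.le
  have h2 : 0 < r⁻¹ := by positivity
  rw [abelParameter, Set.projIcc_of_mem _ ⟨by linarith, by linarith⟩]

theorem abelMean_eq_resolvent {T : X →L[ℂ] X} {M : ℝ}
    (hM : ∀ n x, ‖(T ^ n) x‖ ≤ M * ‖x‖) {c : ℂ} (hc : ‖c‖ = 1) (x : X) {r : ℝ} (hr : 1 < r) :
    ∫ n, c⁻¹ ^ n • (T ^ n) x ∂geometricMeasure (abelParameter r) =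
      ((r : ℂ) * c - c) • resolvent T ((r : ℂ) * c) x := by
  have hr0 : (0 : ℝ) < r := by linarith
  have hrC : (r : ℂ) ≠ 0 := by exact_mod_cast hr0.ne'
  have hc0 : c ≠ 0 := by rintro rfl; simp at hc
  have hp : abelParameter r ≠ 0 := by
    intro h
    have := coe_abelParameter hr
    rw [h] at this
    have h1 : r⁻¹ < 1 := inv_lt_one_of_one_lt₀ hr
    simp at this
    linarith
  have hint : Integrable (fun n => c⁻¹ ^ n • (T ^ n) x) (geometricMeasure (abelParameter r)) :=
    Integrable.of_bound AEStronglyMeasurable.of_discrete (M * ‖x‖)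
      (Eventually.of_forall fun n => by simpa [norm_smul, hc] using hM n x)
  have hsum := hasSum_integral_geometricMeasure hp hint
  set A := ∫ n, c⁻¹ ^ n • (T ^ n) x ∂geometricMeasure (abelParameter r)
  rw [coe_abelParameter hr] at hsum
  simp only [sub_sub_cancel] at hsum
  have hz : ((r : ℂ) * c) ∈ resolventSet ℂ T := mem_resolventSet_of_power_bounded hM (by
    rw [norm_mul, hc, mul_one, Complex.norm_real, Real.norm_eq_abs, abs_of_pos hr0]; exact hr)
  have h1 := hsum.const_smul ((r : ℂ) * c)
  -- Removing the term `n = 0` from `r c` times the series leaves `T` applied to the series, which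
  -- gives the resolvent equation for `A`.
  rw [← hasSum_nat_add_iff' 1] at h1
  have h2 := hsum.mapL T
  have h3 : (fun n : ℕ => ((r : ℂ) * c) • (r⁻¹ ^ (n + 1) * (1 - r⁻¹)) • c⁻¹ ^ (n + 1) • (T ^ (n + 1)) x)
      = fun n => T ((r⁻¹ ^ n * (1 - r⁻¹)) • c⁻¹ ^ n • (T ^ n) x) := by
    funext n
    simp only [← Complex.coe_smul, smul_smul]
    rw [map_smul, ← mul_apply_eq_comp, ← pow_succ']
    congr 1
    push_cast
    rw [pow_succ, pow_succ]
    field_simp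
  have h4 : ((r : ℂ) * c) • A - T A = ((r : ℂ) * c - c) • x := by
    have h5 := (h3 ▸ h1).unique h2
    rw [← h5, sub_sub_cancel]
    simp only [Finset.sum_range_one, pow_zero, one_mul, one_smul, one_apply_eq_self]
    rw [← Complex.coe_smul, smul_smul]
    congr 1
    push_cast
    field_simp
  rw [← map_smul, ← h4, resolvent_apply_sub hz]

/-- A mean ergodic argument: the Abel means `A r` are bounded and `T (A r) - c A r → 0`, so a weak
limit `y` satisfies `T y = c y`. Since `J` is weakly continuous, `L = J y = 0`. -/
theorem residue_eq_zero {Q : Type*} [NormedAddCommGroup Q] [NormedSpace ℂ Q]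
    {T : X →L[ℂ] X} (hT : IsWeaklyAlmostPeriodicOp T) (J : X →L[ℂ] Q) {c : ℂ} (hc : ‖c‖ = 1)
    (hJ : ∀ y, T y = c • y → J y = 0) (x : X) {L : Q}
    (hL : Tendsto (fun r : ℝ => J (((r : ℂ) * c - c) • resolvent T ((r : ℂ) * c) x))
      (𝓝[>] 1) (𝓝 L)) : L = 0 := by
  obtain ⟨M, hM0, hM⟩ := hT.exists_power_bound
  set A : ℝ → X := fun r => ∫ n, c⁻¹ ^ n • (T ^ n) x ∂geometricMeasure (abelParameter r)
  have hA : ∀ᶠ r : ℝ in 𝓝[>] 1, A r = ((r : ℂ) * c - c) • resolvent T ((r : ℂ) * c) x := by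
    filter_upwards [self_mem_nhdsWithin] with r hr
    exact abelMean_eq_resolvent hM hc x hr
  have hAM : ∀ r, ‖A r‖ ≤ M * ‖x‖ := fun r => by
    refine (norm_integral_le_of_norm_le_const (C := M * ‖x‖) (Eventually.of_forall fun n => ?_)).trans ?_
    · simpa [norm_smul, hc] using hM n x
    · simp
  let U : Ultrafilter ℝ := Ultrafilter.of (𝓝[>] 1)
  have hU : (U : Filter ℝ) ≤ 𝓝[>] 1 := Ultrafilter.of_le _
  obtain ⟨y, hy⟩ := exists_weak_limit_of_averages (isCompact_closure_rotated_orbit hT hc x) U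
    fun r => geometricMeasure (abelParameter r)
  have hsub : Tendsto (fun r : ℝ => (r : ℂ) * c - c) (𝓝[>] 1) (𝓝 0) := by
    have : Continuous fun r : ℝ => (r : ℂ) * c - c := by fun_prop
    simpa using (this.tendsto 1).mono_left nhdsWithin_le_nhds
  have hdefect : Tendsto (fun r => T (A r) - c • A r) (𝓝[>] 1) (𝓝 0) := by
    have h1 : Tendsto (fun r : ℝ => ((r : ℂ) * c - c) • (A r - x)) (𝓝[>] 1) (𝓝 0) := by
      refine hsub.zero_smul_isBoundedUnder_le ⟨M * ‖x‖ + ‖x‖, eventually_map.2 ?_⟩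
      exact Eventually.of_forall fun r => (norm_sub_le _ _).trans (by gcongr; exact hAM r)
    refine h1.congr' ?_
    filter_upwards [hA, self_mem_nhdsWithin] with r hr hr1
    have hr1 : (1 : ℝ) < r := hr1
    have hz : ((r : ℂ) * c) ∈ resolventSet ℂ T := mem_resolventSet_of_power_bounded hM (by
      rw [norm_mul, hc, mul_one, Complex.norm_real, Real.norm_eq_abs, abs_of_pos (by linarith)]
      exact hr1)
    have h2 : ((r : ℂ) * c) • A r - T (A r) = ((r : ℂ) * c - c) • x := by
      rw [hr, map_smul, smul_comm, ← smul_sub, sub_resolvent_apply hz]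
    rw [smul_sub, ← h2, sub_smul]
    abel
  have hTy : T y = c • y := by
    refine sub_eq_zero.1 ((SeparatingDual.eq_zero_iff_forall_dual_eq_zero (R := ℂ) _).2 fun f => ?_)
    have h1 := hy (f ∘L (T - c • ContinuousLinearMap.id ℂ X))
    have h2 := ((f.continuous.tendsto 0).comp hdefect).mono_left hU
    rw [map_zero] at h2
    exact tendsto_nhds_unique h1 h2
  refine (SeparatingDual.eq_zero_iff_forall_dual_eq_zero (R := ℂ) _).2 fun f => ?_
  have h1 := hy (f ∘L J)
  have hLA : Tendsto (fun r => J (A r)) (𝓝[>] 1) (𝓝 L) :=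
    hL.congr' (hA.mono fun r hr => (congrArg J hr).symm)
  have h2 := ((f.continuous.tendsto L).comp hLA).mono_left hU
  have h3 := tendsto_nhds_unique h2 h1
  rw [h3]
  simp [hJ y hTy]

/-- Every orbit approaches the closed span of the unimodular eigenvectors. -/
theorem tendsto_mkQ_orbit {T : X →L[ℂ] X} (hT : IsWeaklyAlmostPeriodicOp T)
    (hσ : (spectrum ℂ T ∩ Metric.sphere (0 : ℂ) 1).Countable) (x : X) :
    Tendsto (fun n : ℕ => (unimodularEigenspan T).mkQ ((T ^ n) x)) atTop (𝓝 0) := by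
  obtain ⟨M, hM0, hM⟩ := hT.exists_power_bound
  have hclosed : IsClosed (unimodularEigenspan T : Set X) :=
    Submodule.isClosed_topologicalClosure _
  let A : ℕ → X →L[ℂ] X ⧸ unimodularEigenspan T := fun n => (unimodularEigenspan T).mkQL ∘L (T ^ n)
  have hA : ∀ n x, ‖A n x‖ ≤ M * ‖x‖ := fun n x =>
    (Submodule.Quotient.norm_mk_le _ _).trans (hM n x)
  refine (limitMap_eq_zero_iff A M hM0 hA x).1 ?_
  refine map_eq_zero_of_intertwining (LimitSpace.shift _) _
    (limitMap_shift A M hM0 hA fun n x => ?_) hσ (fun c hc L hL => ?_)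
    fun z hz => mem_resolventSet_of_power_bounded hM hz
  · simp only [A, ContinuousLinearMap.comp_apply, pow_succ, mul_apply_eq_comp]
  · refine residue_eq_zero hT _ hc (fun y hy => ?_) x hL
    refine (limitMap_eq_zero_iff A M hM0 hA y).2 (tendsto_const_nhds.congr fun n => ?_)
    have hn : (T ^ n) y ∈ unimodularEigenspan T := by
      refine Submodule.le_topologicalClosure _ (Submodule.subset_span ⟨c, hc, ?_⟩)
      rw [← mul_apply_eq_comp, ← pow_succ', pow_succ, mul_apply_eq_comp, hy, map_smul]
    exact ((Submodule.Quotient.mk_eq_zero _).2 hn).symm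

end Ergodic

/-! ### Compactness of orbits and the splitting -/

theorem Metric.totallyBounded_of_approx {α : Type*} [PseudoMetricSpace α] {s : Set α}
    (h : ∀ ε > 0, ∃ t, TotallyBounded t ∧ ∀ a ∈ s, ∃ b ∈ t, dist a b < ε) : TotallyBounded s := by
  rw [Metric.totallyBounded_iff]
  intro ε hε
  obtain ⟨t, ht, hst⟩ := h (ε / 2) (half_pos hε)
  obtain ⟨f, hf, htf⟩ := Metric.totallyBounded_iff.1 ht (ε / 2) (half_pos hε)
  refine ⟨f, hf, fun a ha => ?_⟩
  obtain ⟨b, hb, hab⟩ := hst a ha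
  obtain ⟨y, hy, hby⟩ := Set.mem_iUnion₂.1 (htf hb)
  refine Set.mem_iUnion₂.2 ⟨y, hy, ?_⟩
  have := dist_triangle a b y
  rw [Metric.mem_ball] at hby ⊢
  linarith

/-- Along a suitable ultrafilter the powers of all unimodular numbers converge to `1`. -/
theorem exists_ultrafilter_forall_pow_tendsto_one :
    ∃ U : Ultrafilter ℕ, (U : Filter ℕ) ≤ atTop ∧
      ∀ c : ℂ, ‖c‖ = 1 → Tendsto (fun n : ℕ => c ^ n) U (𝓝 1) := by
  -- In the compact group of all maps `Circle → Circle`, the powers of the identity map cluster at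
  -- the constant `1`.
  obtain ⟨U, hU, hlim⟩ := mapClusterPt_iff_ultrafilter.1
    (mapClusterPt_one_atTop_pow (fun c : Circle => c))
  refine ⟨U, hU, fun c hc => ?_⟩
  have h1 := (tendsto_pi_nhds.1 hlim) (⟨c, mem_sphere_zero_iff_norm.2 hc⟩ : Circle)
  exact ((by fun_prop : Continuous fun u : Circle => (u : ℂ)).tendsto 1).comp h1

section

variable {X : Type*} [NormedAddCommGroup X] [NormedSpace ℂ X] {T : X →L[ℂ] X}

theorem pow_apply_of_eigenvector {c : ℂ} {y : X} (hy : T y = c • y) (n : ℕ) :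
    (T ^ n) y = c ^ n • y := by
  induction n with
  | zero => simp
  | succ n ih => rw [pow_succ', mul_apply_eq_comp, ih, map_smul, hy, smul_smul, pow_succ]

theorem totallyBounded_orbit_of_mem_unimodularEigenspan [CompleteSpace X] {M : ℝ} (hM0 : 0 ≤ M)
    (hM : ∀ n x, ‖(T ^ n) x‖ ≤ M * ‖x‖) {y : X} (hy : y ∈ unimodularEigenspan T) :
    TotallyBounded (Set.range fun n : ℕ => (T ^ n) y) := by
  have hspan : ∀ s ∈ Submodule.span ℂ {y : X | ∃ c : ℂ, ‖c‖ = 1 ∧ T y = c • y},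
      TotallyBounded (Set.range fun n : ℕ => (T ^ n) s) := by
    intro s hs
    induction hs using Submodule.span_induction with
    | mem y hy =>
      obtain ⟨c, hc, hy⟩ := hy
      refine (((isCompact_sphere (0 : ℂ) 1).image
        (f := fun c : ℂ => c • y) (by fun_prop)).totallyBounded).subset ?_
      rintro _ ⟨n, rfl⟩
      exact ⟨c ^ n, by simp [hc], (pow_apply_of_eigenvector hy n).symm⟩
    | zero =>
      refine (Set.finite_singleton (0 : X)).totallyBounded.subset ?_
      rintro _ ⟨n, rfl⟩
      simp
    | add a b _ _ ha hb =>
      refine ((ha.closure.isCompact_of_isClosed isClosed_closure).add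
        (hb.closure.isCompact_of_isClosed isClosed_closure)).totallyBounded.subset ?_
      rintro _ ⟨n, rfl⟩
      exact Set.mem_add.2 ⟨_, subset_closure (Set.mem_range_self n), _,
        subset_closure (Set.mem_range_self n), (map_add _ _ _).symm⟩
    | smul c a _ ha =>
      refine (ha.image (uniformContinuous_const_smul c)).subset ?_
      rintro _ ⟨n, rfl⟩
      exact ⟨(T ^ n) a, Set.mem_range_self n, (map_smul _ _ _).symm⟩
  refine Metric.totallyBounded_of_approx fun ε hε => ?_
  obtain ⟨s, hs, hys⟩ := Metric.mem_closure_iff.1 hy (ε / (M + 1)) (by positivity)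
  refine ⟨_, hspan s hs, ?_⟩
  rintro _ ⟨n, rfl⟩
  refine ⟨_, Set.mem_range_self n, ?_⟩
  rw [dist_eq_norm] at hys ⊢
  rw [lt_div_iff₀ (by positivity)] at hys
  dsimp only
  rw [← map_sub]
  nlinarith [hM n (y - s), norm_nonneg (y - s)]

theorem tendsto_pow_apply_of_mem_unimodularEigenspan {M : ℝ} (hM0 : 0 ≤ M)
    (hM : ∀ n x, ‖(T ^ n) x‖ ≤ M * ‖x‖) {U : Ultrafilter ℕ}
    (hU : ∀ c : ℂ, ‖c‖ = 1 → Tendsto (fun n : ℕ => c ^ n) U (𝓝 1))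
    {y : X} (hy : y ∈ unimodularEigenspan T) : Tendsto (fun n : ℕ => (T ^ n) y) U (𝓝 y) := by
  have hspan : ∀ s ∈ Submodule.span ℂ {y : X | ∃ c : ℂ, ‖c‖ = 1 ∧ T y = c • y},
      Tendsto (fun n : ℕ => (T ^ n) s) U (𝓝 s) := by
    intro s hs
    induction hs using Submodule.span_induction with
    | mem y hy =>
      obtain ⟨c, hc, hy⟩ := hy
      simpa [pow_apply_of_eigenvector hy] using (hU c hc).smul_const y
    | zero => simp
    | add a b _ _ ha hb => simpa using ha.add hb
    | smul c a _ ha => simpa using ha.const_smul c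
  rw [Metric.tendsto_nhds]
  intro ε hε
  obtain ⟨s, hs, hys⟩ := Metric.mem_closure_iff.1 hy (ε / (2 * (M + 1))) (by positivity)
  filter_upwards [Metric.tendsto_nhds.1 (hspan s hs) (ε / 2) (half_pos hε)] with n hn
  rw [dist_eq_norm] at hys hn ⊢
  rw [lt_div_iff₀ (by positivity)] at hys
  calc ‖(T ^ n) y - y‖ = ‖(T ^ n) (y - s) + ((T ^ n) s - s) - (y - s)‖ := by
        congr 1; rw [map_sub]; abel
    _ ≤ ‖(T ^ n) (y - s)‖ + ‖(T ^ n) s - s‖ + ‖y - s‖ :=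
        (norm_sub_le _ _).trans (by gcongr; exact norm_add_le _ _)
    _ < ε := by nlinarith [hM n (y - s)]

theorem totallyBounded_orbit [CompleteSpace X] {M : ℝ} (hM0 : 0 ≤ M)
    (hM : ∀ n x, ‖(T ^ n) x‖ ≤ M * ‖x‖) {x : X}
    (hx : Tendsto (fun n : ℕ => (unimodularEigenspan T).mkQ ((T ^ n) x)) atTop (𝓝 0)) :
    TotallyBounded (Set.range fun n : ℕ => (T ^ n) x) := by
  refine Metric.totallyBounded_of_approx fun ε hε => ?_
  -- One half bounds the quotient norm, the other pays for a near-optimal representative `m`; `M +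
  -- 1` avoids dividing by zero.
  have hδ : 0 < ε / (M + 1) / 2 := by positivity
  obtain ⟨N, hN⟩ := ((tendsto_zero_iff_norm_tendsto_zero.1 hx).eventually_lt_const hδ).exists
  obtain ⟨m, hm, hmN⟩ := Submodule.Quotient.norm_mk_lt
    ((unimodularEigenspan T).mkQ ((T ^ N) x)) hδ
  have hy : (T ^ N) x - m ∈ unimodularEigenspan T := (Submodule.Quotient.eq _).1 hm.symm
  have hm' : ‖m‖ * (M + 1) < ε := by
    rw [← lt_div_iff₀ (by positivity)]
    linarith
  refine ⟨_, (totallyBounded_orbit_of_mem_unimodularEigenspan hM0 hM hy).union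
    ((Set.finite_lt_nat N).image fun n => (T ^ n) x).totallyBounded, ?_⟩
  rintro _ ⟨n, rfl⟩
  rcases lt_or_ge n N with h | h
  · exact ⟨(T ^ n) x, Or.inr ⟨n, h, rfl⟩, by simpa using hε⟩
  · refine ⟨(T ^ (n - N)) ((T ^ N) x - m), Or.inl ⟨n - N, rfl⟩, ?_⟩
    dsimp only
    rw [map_sub, ← mul_apply_eq_comp, ← pow_add, Nat.sub_add_cancel h, dist_eq_norm,
      sub_sub_cancel]
    nlinarith [hM (n - N) m, norm_nonneg m]

/-- Power boundedness turns a single small iterate into smallness of all later ones. -/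
theorem mem_stableSubspace_of_tendsto {M : ℝ} (hM0 : 0 ≤ M) (hM : ∀ n x, ‖(T ^ n) x‖ ≤ M * ‖x‖)
    {l : Filter ℕ} [l.NeBot] {z : X} (hz : Tendsto (fun n : ℕ => (T ^ n) z) l (𝓝 0)) :
    z ∈ stableSubspace T := by
  refine Metric.tendsto_atTop.2 fun ε hε => ?_
  obtain ⟨N, hN⟩ := ((tendsto_zero_iff_norm_tendsto_zero.1 hz).eventually_lt_const
    (show 0 < ε / (M + 1) by positivity)).exists
  rw [lt_div_iff₀ (by positivity)] at hN
  refine ⟨N, fun n hn => ?_⟩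
  have h := hM (n - N) ((T ^ N) z)
  rw [← mul_apply_eq_comp, ← pow_add, Nat.sub_add_cancel hn] at h
  rw [dist_zero_right, norm_norm]
  nlinarith [norm_nonneg ((T ^ N) z)]

theorem isClosed_stableSubspace {M : ℝ} (hM0 : 0 ≤ M) (hM : ∀ n x, ‖(T ^ n) x‖ ≤ M * ‖x‖) :
    IsClosed (stableSubspace T : Set X) := by
  refine isClosed_of_closure_subset fun z hz => ?_
  refine Metric.tendsto_atTop.2 fun ε hε => ?_
  obtain ⟨s, hs, hzs⟩ := Metric.mem_closure_iff.1 hz (ε / (2 * (M + 1))) (by positivity)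
  obtain ⟨N, hN⟩ := Metric.tendsto_atTop.1 hs (ε / 2) (half_pos hε)
  refine ⟨N, fun n hn => ?_⟩
  have h1 := hN n hn
  rw [dist_zero_right, norm_norm] at h1 ⊢
  rw [dist_eq_norm, lt_div_iff₀ (by positivity)] at hzs
  have h2 : ‖(T ^ n) z‖ ≤ ‖(T ^ n) (z - s)‖ + ‖(T ^ n) s‖ := by
    rw [map_sub]
    exact norm_le_norm_sub_add _ _
  nlinarith [hM n (z - s), norm_nonneg (z - s)]

end

theorem mainTheorem6 {X : Type*} [NormedAddCommGroup X] [NormedSpace ℂ X] [CompleteSpace X]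
    (T : X →L[ℂ] X) (hT : IsWeaklyAlmostPeriodicOp T)
    (hσ : (spectrum ℂ T ∩ Metric.sphere (0 : ℂ) 1).Countable) :
    IsAlmostPeriodicOp T ∧
      Submodule.IsTopCompl (unimodularEigenspan T) (stableSubspace T) := by
  obtain ⟨M, hM0, hM⟩ := hT.exists_power_bound
  have hap : IsAlmostPeriodicOp T := fun x =>
    (totallyBounded_orbit hM0 hM (tendsto_mkQ_orbit hT hσ x)).closure.isCompact_of_isClosed
      isClosed_closure
  have hclosed : IsClosed (unimodularEigenspan T : Set X) :=
    Submodule.isClosed_topologicalClosure _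
  obtain ⟨U, hUtop, hU⟩ := exists_ultrafilter_forall_pow_tendsto_one
  refine ⟨hap, Submodule.IsCompl.isTopCompl_of_isClosed ⟨?_, ?_⟩ hclosed
    (isClosed_stableSubspace hM0 hM)⟩
  · rw [Submodule.disjoint_def]
    intro y hy1 hy2
    have h1 := tendsto_pow_apply_of_mem_unimodularEigenspan hM0 hM hU hy1
    have h2 : Tendsto (fun n : ℕ => (T ^ n) y) U (𝓝 0) :=
      (tendsto_zero_iff_norm_tendsto_zero.2 hy2).mono_left hUtop
    exact tendsto_nhds_unique h1 h2
  · rw [codisjoint_iff, Submodule.eq_top_iff']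
    intro x
    -- Here `y` is the limit of `Tⁿ x` along `U`. It lies in the eigenspan, so `Tⁿ y → y` too, and
    -- `Tⁿ (x - y) → 0` along `U`.
    obtain ⟨y, -, hy⟩ := (hap x).ultrafilter_le_nhds' (U.map fun n : ℕ => (T ^ n) x)
      (Ultrafilter.mem_map.2 (Filter.univ_mem' fun n => subset_closure (Set.mem_range_self n)))
    have hy : Tendsto (fun n : ℕ => (T ^ n) x) U (𝓝 y) := hy
    have hyS : y ∈ unimodularEigenspan T := by
      have h1 := ((unimodularEigenspan T).mkQL.continuous.tendsto y).comp hy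
      have h2 := (tendsto_mkQ_orbit hT hσ x).mono_left hUtop
      exact (Submodule.Quotient.mk_eq_zero _).1 (tendsto_nhds_unique h1 h2)
    have hxy : x - y ∈ stableSubspace T := by
      refine mem_stableSubspace_of_tendsto hM0 hM (l := U) ?_
      simpa using hy.sub (tendsto_pow_apply_of_mem_unimodularEigenspan hM0 hM hU hyS)
    exact Submodule.mem_sup.2 ⟨y, hyS, x - y, hxy, add_sub_cancel y x⟩
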